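/- For $d\ge 3$ and $n>d$ with $nd$ even, let $G_{n,d}$ be a uniformly random simple $d$-regular graph on the vertex set $\{1,\dots,n\}$. A function $f:V(G)\to\mathbb{R}$ on the vertex set of a graph $G$ is called Lipschitz if $|f(v)-f(w)|\le 1$ for every pair of adjacent vertices $v,w$. A real number $m$ is a median of $f$ if $|\{v: f(v)\le m\}|\ge |V(G)|/2$ and $|\{v: f(v)\ge m\}|\ge |V(G)|/2$. **Theorem.** Fix $d\ge 3$. There exists a constant $c>0$ such that, with probability tending to $1$ as $n\to\infty$ (through those $n$ for which $nd$ is even), $G_{n,d}$ has the following property: for every Lipschitz function $f:V(G_{n,d})\to\mathbb{R}$, every median $m$ of $f$ and every real $x\ge 1$, $$\bigl|\{v : |f(v)-m|\ge x\}\bigr| < e^{-cx}\,n .$$ -/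

import Mathlib

open Filter Topology

/-- The finite set of all (simple, labelled) `d`-regular graphs on the vertex set `Fin n`. -/
noncomputable def regularGraphs (n d : ℕ) : Finset (SimpleGraph (Fin n)) :=
  open Classical in Finset.univ.filter fun G => G.IsRegularOfDegree d

/-- The probability that the random `d`-regular graph on `n` vertices, i.e. a uniformly random
element of `regularGraphs n d`, has the property `P`. -/
noncomputable def probRegular (n d : ℕ) (P : SimpleGraph (Fin n) → Prop) : ℝ :=
  open Classical in
  (((regularGraphs n d).filter P).card : ℝ) / ((regularGraphs n d).card : ℝ)

/-- The random `d`-regular graph has the property `P` with high probability: the probability of `P`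
tends to `1` as `n → ∞` through the integers for which `n * d` is even (for `n * d` odd there are
no `d`-regular graphs on `n` vertices; for `n * d` even and `n > d` there are some). -/
def WhpRegular (d : ℕ) (P : ∀ n : ℕ, SimpleGraph (Fin n) → Prop) : Prop :=
  Tendsto (fun n : ℕ => probRegular n d (P n)) (atTop ⊓ 𝓟 {n : ℕ | Even (n * d)}) (𝓝 1)

/-- A Lipschitz function on a graph: the values at adjacent vertices differ by at most `1`. -/
def IsLipschitzOn {V : Type*} (G : SimpleGraph V) (f : V → ℝ) : Prop :=
  ∀ v w : V, G.Adj v w → |f v - f w| ≤ 1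

/-- `m` is a median of `f` evaluated at a uniformly random element of `V`: at least half of the
elements satisfy `f v ≤ m` and at least half of them satisfy `m ≤ f v`. -/
def IsMedian {V : Type*} [Fintype V] (f : V → ℝ) (m : ℝ) : Prop :=
  Fintype.card V ≤ 2 * {v : V | f v ≤ m}.ncard ∧ Fintype.card V ≤ 2 * {v : V | m ≤ f v}.ncard

/-!
The theorem follows from edge expansion. In an expander the closed neighbourhood of a set of at most
half of the vertices is larger than the set by a constant factor, and for a Lipschitz function `f`
with median `m` the closed neighbourhood of `{m + r ≤ f}` lies in `{m + r - 1 ≤ f}`. So the level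
sets on either side of the median shrink geometrically (`IsEdgeExpander.card_deviation_lt`).

That a random `d`-regular graph is an edge expander is proved by switchings inside the set of simple
`d`-regular graphs, with no passage through the configuration model. For a vertex set `S` let `N k`
be the number of `d`-regular graphs with exactly `k` edges leaving `S`. Replacing an edge `uv` inside
`S` and an edge `xy` outside `S` by `ux` and `vy` gives (`card_graphsWithCut_mul_le`)

  `N k * (d |S| - k) * (d (n - |S|) - 2 d ^ 2 - k) ≤ N (k + 2) * (k + 2) * (k + 1)`.

With equality, this is the recursion satisfied by the number of pairs leaving a set of `a = d |S|`
points in a uniformly random pairing of `2 M = d n - 2 d ^ 2` points. Hence the cut of `S` in the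
random regular graph stochastically dominates the cut in the pairing, whose distribution is explicit
(`pairWeight`, `sum_tail_mul_choose_le`): with `i = (a - k) / 2` pairs inside the set, it is
`2 ^ k * (M choose i) * (M - i choose k) / (2 M choose a)`.

By Vandermonde's inequality, this is at most `2 ^ k (M choose k) / (M choose a - i)`, while
`(M choose a - i)` is at least `(n choose s) * (M - n choose a - i - s)` for `s = |S|`. The factor
`(n choose s)` cancels the union bound over the sets of size `s`. As `d ≥ 3`, the other one is at
least `(0.9 n / s) ^ (s / 2)`, which beats `2 ^ k (M choose k)` when `k ≤ s / (1000 d)`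
(`choose_mul_card_few_crossing_le`). So the expected number of nonexpanding sets is at most
`∑ s, (d s + 1) (s / n) ^ (s / 4)` over `1 ≤ s ≤ n / 2`, which tends to zero
(`tendsto_sum_mul_exp_log`).
-/

/-! ### Switchings in regular graphs -/

section Switching
open Finset SimpleGraph
open scoped Classical symmDiff

variable {n d : ℕ}

lemma mem_regularGraphs {G : SimpleGraph (Fin n)} :
    G ∈ regularGraphs n d ↔ ∀ v, #{w | G.Adj v w} = d := by
  rw [regularGraphs, Finset.mem_filter]
  simp only [mem_univ, true_and, IsRegularOfDegree]
  refine forall_congr' fun v => ?_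
  rw [← card_neighborFinset_eq_degree]
  have : G.neighborFinset v = ({w | G.Adj v w} : Finset (Fin n)) := by
    ext w; simp
  rw [this]

/-- The ordered pairs of adjacent vertices from `S` to `T`. -/
noncomputable def arcs (G : SimpleGraph (Fin n)) (S T : Finset (Fin n)) :
    Finset (Fin n × Fin n) :=
  (S ×ˢ T).filter fun p => G.Adj p.1 p.2

lemma mem_arcs {G : SimpleGraph (Fin n)} {S T : Finset (Fin n)} {u v : Fin n} :
    (u, v) ∈ arcs G S T ↔ u ∈ S ∧ v ∈ T ∧ G.Adj u v := by
  simp [arcs, and_assoc]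

lemma card_arcs_eq_sum (G : SimpleGraph (Fin n)) (S T : Finset (Fin n)) :
    #(arcs G S T) = ∑ u ∈ S, #{w ∈ T | G.Adj u w} := by
  simp only [arcs, card_filter, sum_product]

lemma card_arcs_comm (G : SimpleGraph (Fin n)) (S T : Finset (Fin n)) :
    #(arcs G S T) = #(arcs G T S) := by
  rw [← card_map (Equiv.prodComm (Fin n) (Fin n)).toEmbedding]
  congr 1
  ext ⟨p, q⟩
  simp [arcs, G.adj_comm, and_comm]

lemma card_arcs_add_compl {G : SimpleGraph (Fin n)} (hG : G ∈ regularGraphs n d)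
    (S : Finset (Fin n)) :
    #(arcs G S S) + #(arcs G S Sᶜ) = d * #S := by
  rw [card_arcs_eq_sum, card_arcs_eq_sum, ← sum_add_distrib, mul_comm,
    ← smul_eq_mul, ← sum_const]
  refine sum_congr rfl fun u _ => ?_
  rw [← mem_regularGraphs.1 hG u, ← card_union_of_disjoint, ← filter_union, union_compl]
  exact (disjoint_compl_right).mono (filter_subset _ _) (filter_subset _ _)

lemma card_arcs_compl_compl {G : SimpleGraph (Fin n)} (hG : G ∈ regularGraphs n d)
    (S : Finset (Fin n)) :
    #(arcs G Sᶜ Sᶜ) + #(arcs G S Sᶜ) = d * (n - #S) := by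
  have := card_arcs_add_compl hG Sᶜ
  rw [compl_compl, card_compl, Fintype.card_fin] at this
  rw [← this, card_arcs_comm G S]

/-- Reversal is a fixed-point-free involution of the arcs inside `S`. -/
lemma even_card_arcs_self (G : SimpleGraph (Fin n)) (S : Finset (Fin n)) :
    Even #(arcs G S S) := by
  have h : ∑ _p ∈ arcs G S S, (1 : ZMod 2) = 0 := by
    refine sum_involution (fun p _ => p.swap) (fun _ _ => by decide) ?_ ?_ ?_
    · rintro ⟨u, v⟩ hp - h
      rw [mem_arcs] at hp
      simp only [Prod.swap_prod_mk, Prod.mk.injEq] at h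
      exact hp.2.2.ne h.2
    · rintro ⟨u, v⟩ hp
      rw [mem_arcs] at hp
      simp only [Prod.swap_prod_mk, mem_arcs]
      exact ⟨hp.2.1, hp.1, hp.2.2.symm⟩
    · simp
  rw [sum_const, nsmul_one, ZMod.natCast_eq_zero_iff] at h
  exact even_iff_two_dvd.2 h

/-- The graph whose edges are those of the 4-cycle `u v y x`. Switching the edges `uv`, `xy` of `G`
to `ux`, `vy` is the symmetric difference of `G` with this graph, which makes it visibly
injective in `G`. -/
def fourCycle (u v x y : Fin n) : SimpleGraph (Fin n) :=
  fromEdgeSet {s(u, v), s(x, y), s(u, x), s(v, y)}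

lemma symmDiff_adj (G H : SimpleGraph (Fin n)) (p q : Fin n) :
    (G ∆ H).Adj p q ↔ (G.Adj p q ∧ ¬ H.Adj p q ∨ H.Adj p q ∧ ¬ G.Adj p q) := by
  simp [symmDiff_def]

lemma card_insert_erase {α : Type*} {s : Finset α} {a b : α} (ha : a ∈ s) (hb : b ∉ s) :
    #(insert b (s.erase a)) = #s := by
  rw [card_insert_of_notMem (fun h => hb (mem_of_mem_erase h)), card_erase_add_one ha]

/-- The edge `uv` inside `S` and the edge `xy` outside `S` can be replaced by `ux` and `vy`. -/
structure Switchable (G : SimpleGraph (Fin n)) (S : Finset (Fin n)) (u v x y : Fin n) : Prop where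
  hu : u ∈ S
  hv : v ∈ S
  hx : x ∉ S
  hy : y ∉ S
  huv : G.Adj u v
  hxy : G.Adj x y
  hux : ¬ G.Adj u x
  hvy : ¬ G.Adj v y

namespace Switchable
variable {G : SimpleGraph (Fin n)} {S : Finset (Fin n)} {u v x y : Fin n}

lemma swap (h : Switchable G S u v x y) : Switchable G S v u y x :=
  ⟨h.hv, h.hu, h.hy, h.hx, h.huv.symm, h.hxy.symm, h.hvy, h.hux⟩

lemma compl (h : Switchable G S u v x y) : Switchable G Sᶜ x y u v :=
  ⟨by simpa using h.hx, by simpa using h.hy, by simpa using h.hu, by simpa using h.hv,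
    h.hxy, h.huv, fun e => h.hux e.symm, fun e => h.hvy e.symm⟩

lemma fourCycle_swap (u v x y : Fin n) : fourCycle u v x y = fourCycle v u y x := by
  unfold fourCycle; congr 1; ext e
  simp only [Set.mem_insert_iff, Set.mem_singleton_iff, Sym2.eq_swap (a := v) (b := u),
    Sym2.eq_swap (a := y) (b := x)]
  tauto

lemma fourCycle_compl (u v x y : Fin n) : fourCycle u v x y = fourCycle x y u v := by
  unfold fourCycle; congr 1; ext e
  simp only [Set.mem_insert_iff, Set.mem_singleton_iff, Sym2.eq_swap (a := x) (b := u),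
    Sym2.eq_swap (a := y) (b := v)]
  tauto

lemma ne (h : Switchable G S u v x y) : u ≠ v ∧ x ≠ y ∧ u ≠ x ∧ u ≠ y ∧ v ≠ x ∧ v ≠ y :=
  ⟨h.huv.ne, h.hxy.ne, fun e => h.hx (e ▸ h.hu), fun e => h.hy (e ▸ h.hu),
    fun e => h.hx (e ▸ h.hv), fun e => h.hy (e ▸ h.hv)⟩

lemma degree_fst (h : Switchable G S u v x y) :
    #{w | (G ∆ fourCycle u v x y).Adj u w} = #{w | G.Adj u w} := by
  obtain ⟨h1, h2, h3, h4, h5, h6⟩ := h.ne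
  have : ({w | (G ∆ fourCycle u v x y).Adj u w} : Finset (Fin n)) =
      insert x (({w | G.Adj u w} : Finset (Fin n)).erase v) := by
    ext w
    have hw : (fourCycle u v x y).Adj u w ↔ (w = v ∨ w = x) := by
      simp only [fourCycle, fromEdgeSet_adj, Set.mem_insert_iff, Set.mem_singleton_iff,
        Sym2.eq_iff]
      grind
    simp only [mem_filter, mem_univ, true_and, symmDiff_adj, hw, mem_insert, mem_erase]
    have := h.huv
    have := h.hux
    grind
  rw [this]
  convert card_insert_erase (s := ({w | G.Adj u w} : Finset (Fin n))) (a := v) (b := x) ?_ ?_ <;>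
    simp [h.huv, h.hux]

lemma mem_regularGraphs (h : Switchable G S u v x y) (hG : G ∈ regularGraphs n d) :
    G ∆ fourCycle u v x y ∈ regularGraphs n d := by
  rw [_root_.mem_regularGraphs] at hG ⊢
  intro w
  rw [← hG w]
  by_cases hu : w = u
  · subst hu; exact h.degree_fst
  by_cases hv : w = v
  · subst hv; rw [fourCycle_swap]; exact h.swap.degree_fst
  by_cases hx : w = x
  · subst hx; rw [fourCycle_compl]; exact h.compl.degree_fst
  by_cases hy : w = y
  · subst hy; rw [fourCycle_compl, fourCycle_swap]; exact h.compl.swap.degree_fst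
  congr 1
  ext z
  have hz : ¬ (fourCycle u v x y).Adj w z := by
    simp only [fourCycle, fromEdgeSet_adj, Set.mem_insert_iff, Set.mem_singleton_iff, Sym2.eq_iff]
    grind
  simp [symmDiff_adj, hz]

lemma arcs_eq (h : Switchable G S u v x y) :
    arcs (G ∆ fourCycle u v x y) S Sᶜ =
      insert (u, x) (insert (v, y) (arcs G S Sᶜ)) := by
  obtain ⟨hu, hv, hx, hy, huv, hxy, hux, hvy⟩ := h
  ext ⟨p, q⟩
  simp only [mem_arcs, mem_insert, symmDiff_adj, mem_compl, Prod.mk.injEq]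
  by_cases hpq : p ∈ S ∧ q ∉ S
  · have hC : (fourCycle u v x y).Adj p q ↔ (p = u ∧ q = x) ∨ (p = v ∧ q = y) := by
      simp only [fourCycle, fromEdgeSet_adj, Set.mem_insert_iff, Set.mem_singleton_iff,
        Sym2.eq_iff]
      grind
    rw [hC]
    grind
  · grind

lemma card_arcs (h : Switchable G S u v x y) :
    #(arcs (G ∆ fourCycle u v x y) S Sᶜ) = #(arcs G S Sᶜ) + 2 := by
  rw [h.arcs_eq, card_insert_of_notMem, card_insert_of_notMem]
  · simp [mem_arcs, h.hvy]
  · simp [mem_arcs, h.hux, h.ne.1]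

end Switchable

/-- The `d`-regular graphs in which exactly `k` edges leave `S`. -/
noncomputable def graphsWithCut (d : ℕ) (S : Finset (Fin n)) (k : ℕ) :
    Finset (SimpleGraph (Fin n)) :=
  (regularGraphs n d).filter fun G => #(arcs G S Sᶜ) = k

/-- The pairs of an ordered edge `(u, v)` inside `S` and an ordered edge `(x, y)` outside `S` that
can be switched. -/
noncomputable def switchings (G : SimpleGraph (Fin n)) (S : Finset (Fin n)) :
    Finset ((Fin n × Fin n) × (Fin n × Fin n)) :=
  (arcs G S S ×ˢ arcs G Sᶜ Sᶜ).filter fun e =>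
    ¬ G.Adj e.1.1 e.2.1 ∧ ¬ G.Adj e.1.2 e.2.2

lemma mem_switchings {G : SimpleGraph (Fin n)} {S : Finset (Fin n)} {u v x y : Fin n} :
    ((u, v), (x, y)) ∈ switchings G S ↔ Switchable G S u v x y := by
  simp only [switchings, mem_filter, mem_product, mem_arcs, mem_compl]
  constructor
  · rintro ⟨⟨⟨h1, h2, h3⟩, h4, h5, h6⟩, h7, h8⟩
    exact ⟨h1, h2, h4, h5, h3, h6, h7, h8⟩
  · rintro ⟨h1, h2, h4, h5, h3, h6, h7, h8⟩
    exact ⟨⟨⟨h1, h2, h3⟩, h4, h5, h6⟩, h7, h8⟩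

lemma card_arcs_from_neighbors_le {G : SimpleGraph (Fin n)} (hG : G ∈ regularGraphs n d)
    (u : Fin n) : #{e : Fin n × Fin n | G.Adj u e.1 ∧ G.Adj e.1 e.2} ≤ d * d := by
  have hd := mem_regularGraphs.1 hG
  calc #{e : Fin n × Fin n | G.Adj u e.1 ∧ G.Adj e.1 e.2}
      = #(({x | G.Adj u x} : Finset (Fin n)).sigma fun x => ({y | G.Adj x y} : Finset (Fin n))) := by
        refine card_bij (fun e _ => ⟨e.1, e.2⟩) ?_ ?_ ?_ <;> simp
        · rintro a b c e - - - - rfl rfl; simp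
        · rintro ⟨x, y⟩ h1 h2; exact ⟨x, y, ⟨h1, h2⟩, rfl⟩
    _ ≤ d * d := by rw [card_sigma]; simp [hd]

/-- For each edge `uv` inside `S`, at most `2 d ^ 2` ordered edges `(x, y)` outside `S` have `x`
adjacent to `u` or `y` adjacent to `v`. The loss does not depend on the cut, which keeps the
bound useful when few edges are left inside `S`. -/
lemma card_switchings_ge {G : SimpleGraph (Fin n)} (hG : G ∈ regularGraphs n d)
    (S : Finset (Fin n)) :
    #(arcs G S S) * (#(arcs G Sᶜ Sᶜ) - 2 * d ^ 2) ≤ #(switchings G S) := by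
  have key : ∀ e ∈ arcs G S S, #(arcs G Sᶜ Sᶜ) - 2 * d ^ 2 ≤
      #{f ∈ arcs G Sᶜ Sᶜ | ¬ G.Adj e.1 f.1 ∧ ¬ G.Adj e.2 f.2} := by
    rintro ⟨u, v⟩ -
    have hv : #{e : Fin n × Fin n | G.Adj v e.2 ∧ G.Adj e.2 e.1} ≤ d * d := by
      rw [← card_map (Equiv.prodComm (Fin n) (Fin n)).toEmbedding]
      refine (card_le_card ?_).trans (card_arcs_from_neighbors_le hG v)
      rintro ⟨p, q⟩
      simp
    have hu := card_arcs_from_neighbors_le hG u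
    have hsub : arcs G Sᶜ Sᶜ ⊆
        {f ∈ arcs G Sᶜ Sᶜ | ¬ G.Adj u f.1 ∧ ¬ G.Adj v f.2} ∪
        (({e : Fin n × Fin n | G.Adj u e.1 ∧ G.Adj e.1 e.2} : Finset _) ∪
        ({e : Fin n × Fin n | G.Adj v e.2 ∧ G.Adj e.2 e.1} : Finset _)) := by
      rintro ⟨x, y⟩ h
      have hxy := (mem_arcs.1 h).2.2
      simp only [mem_union, mem_filter, mem_univ, true_and, h, hxy, hxy.symm, and_true]
      tauto
    have h1 := card_le_card hsub
    have h2 := card_union_le {f ∈ arcs G Sᶜ Sᶜ | ¬ G.Adj u f.1 ∧ ¬ G.Adj v f.2}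
        (({e : Fin n × Fin n | G.Adj u e.1 ∧ G.Adj e.1 e.2} : Finset _) ∪
        ({e : Fin n × Fin n | G.Adj v e.2 ∧ G.Adj e.2 e.1} : Finset _))
    have h3 := card_union_le ({e : Fin n × Fin n | G.Adj u e.1 ∧ G.Adj e.1 e.2} : Finset _)
        ({e : Fin n × Fin n | G.Adj v e.2 ∧ G.Adj e.2 e.1} : Finset _)
    have h4 : 2 * d ^ 2 = d * d + d * d := by ring
    simp only
    omega
  rw [switchings, card_filter, sum_product, ← smul_eq_mul, ← sum_const]
  refine sum_le_sum fun e he => ?_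
  rw [← card_filter]
  exact key e he

/-- Double counting of switchings: each of them raises the number of edges leaving `S` by two, and
is recovered from its result and the ordered pair of new edges. -/
lemma card_graphsWithCut_mul_le (S : Finset (Fin n)) (k : ℕ) :
    #(graphsWithCut d S k) * ((d * #S - k) * (d * (n - #S) - k - 2 * d ^ 2)) ≤
      #(graphsWithCut d S (k + 2)) * ((k + 2) * (k + 1)) := by
  calc #(graphsWithCut d S k) * ((d * #S - k) * (d * (n - #S) - k - 2 * d ^ 2))
      ≤ #((graphsWithCut d S k).sigma fun G => switchings G S) := by
        rw [card_sigma]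
        refine card_nsmul_le_sum _ _ _ fun G hG => ?_
        obtain ⟨hG, hk⟩ := mem_filter.1 hG
        have h1 := card_arcs_add_compl hG S
        have h2 := card_arcs_compl_compl hG S
        have h3 := card_switchings_ge hG S
        rwa [show #(arcs G S S) = d * #S - k by omega,
          show #(arcs G Sᶜ Sᶜ) = d * (n - #S) - k by omega] at h3
    _ ≤ #((graphsWithCut d S (k + 2)).sigma fun G => (arcs G S Sᶜ).offDiag) := by
        refine card_le_card_of_injOn
          (fun t => ⟨t.1 ∆ fourCycle t.2.1.1 t.2.1.2 t.2.2.1 t.2.2.2,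
            ((t.2.1.1, t.2.2.1), (t.2.1.2, t.2.2.2))⟩) ?_ ?_
        · rintro ⟨G, ⟨⟨u, v⟩, ⟨x, y⟩⟩⟩ ht
          obtain ⟨hG, hs⟩ := mem_sigma.1 (mem_coe.1 ht)
          obtain ⟨hG, hk⟩ := mem_filter.1 hG
          have hs := mem_switchings.1 hs
          simp only [mem_coe, mem_sigma, graphsWithCut, mem_filter, hs.mem_regularGraphs hG,
            hs.card_arcs, mem_offDiag, true_and]
          refine ⟨by simpa using hk, ?_, ?_, ?_⟩
          · rw [hs.arcs_eq]; simp
          · rw [hs.arcs_eq]; simp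
          · simp [hs.ne.1]
        · rintro ⟨G, ⟨⟨u, v⟩, ⟨x, y⟩⟩⟩ - ⟨G', ⟨⟨u', v'⟩, ⟨x', y'⟩⟩⟩ - h
          obtain ⟨h, he⟩ := Sigma.mk.inj h
          have he := eq_of_heq he
          simp only [Prod.mk.injEq] at he
          obtain ⟨⟨rfl, rfl⟩, rfl, rfl⟩ := he
          have hGG : G = G' := symmDiff_left_injective _ h
          rw [hGG]
    _ = _ := by
        rw [card_sigma]
        refine sum_const_nat fun G hG => ?_
        rw [offDiag_card, (mem_filter.1 hG).2, ← Nat.mul_sub_one]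
        rfl

end Switching

/-! ### The cut of a random pairing -/

section Weights
open Finset Polynomial

/-- The number of `a`-element subsets of the `2 * M` points of a perfect matching that contain both
ends of exactly `i` edges, and hence one end of exactly `a - 2 * i` edges. Meant for `2 * i ≤ a`;
divided by `(2 * M).choose a`, it is the probability that a uniformly random pairing of `2 * M`
points has exactly `i` pairs inside a given set of `a` points. -/
def pairWeight (M a i : ℕ) : ℕ := 2 ^ (a - 2 * i) * (M.choose i * (M - i).choose (a - 2 * i))

lemma coeff_one_add_two_mul_X_pow (m j : ℕ) :
    ((1 + C 2 * X : ℕ[X]) ^ m).coeff j = 2 ^ j * m.choose j := by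
  have : (1 + C 2 * X : ℕ[X]) ^ m = ((1 + X) ^ m : ℕ[X]).comp (C 2 * X) := by simp
  rw [this, comp_C_mul_X_coeff, coeff_one_add_X_pow]
  simp [mul_comm]

/-- Compare the coefficients in `(1 + X) ^ (2 * M) = (X ^ 2 + (1 + 2 * X)) ^ M`. -/
lemma sum_pairWeight (M a : ℕ) :
    ∑ i ∈ range (a / 2 + 1), pairWeight M a i = (2 * M).choose a := by
  have h : ((1 + X) ^ (2 * M) : ℕ[X]) = (X ^ 2 + (1 + C 2 * X)) ^ M := by
    rw [pow_mul]; congr 1; simp only [map_ofNat]; ring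
  have := congrArg (fun p => p.coeff a) h
  rw [coeff_one_add_X_pow, add_pow, finsetSum_coeff] at this
  have hterm : ∀ i, ((X ^ 2) ^ i * (1 + C 2 * X) ^ (M - i) * (M.choose i : ℕ[X])).coeff a =
      if 2 * i ≤ a then pairWeight M a i else 0 := by
    intro i
    rw [← pow_mul, coeff_mul_natCast, coeff_X_pow_mul']
    split_ifs
    · rw [coeff_one_add_two_mul_X_pow, pairWeight]; simp; ring
    · simp
  simp only [hterm] at this
  rw [← sum_filter, Nat.cast_id] at this
  rw [this]
  symm
  refine sum_subset_zero_on_sdiff (fun i hi => ?_) (fun i hi => ?_) (fun _ _ => rfl)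
  · simp only [Finset.mem_filter, mem_range] at hi ⊢; omega
  · simp only [Finset.mem_sdiff, Finset.mem_filter, Finset.mem_range, not_and] at hi
    have : M < i := by
      by_contra h
      exact hi.2 (by omega) (by omega)
    simp [pairWeight, Nat.choose_eq_zero_of_lt this]

lemma pairWeight_succ {M a i : ℕ} (hi : 2 * (i + 1) ≤ a) (hM : a ≤ M + i) :
    pairWeight M a (i + 1) * (2 * (i + 1) * (2 * (M + (i + 1) - a))) =
      pairWeight M a i * ((a - 2 * i) * (a - 2 * i - 1)) := by
  obtain ⟨k, rfl⟩ := Nat.exists_eq_add_of_le hi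
  obtain ⟨r, hr⟩ := Nat.exists_eq_add_of_le hM
  have hM' : M = i + (k + r + 2) := by omega
  have e1 : M.choose (i + 1) * (i + 1) = M.choose i * (k + r + 2) := by
    rw [Nat.choose_succ_right_eq]; congr 1; omega
  have e2 : (k + r + 2).choose (k + 2) * (k + 2) = (k + r + 2) * (k + r + 1).choose (k + 1) :=
    (Nat.add_one_mul_choose_eq (k + r + 1) (k + 1)).symm
  have e3 : (k + r + 1).choose (k + 1) * (k + 1) = (k + r + 1).choose k * (r + 1) := by
    rw [Nat.choose_succ_right_eq]; congr 1; omega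
  unfold pairWeight
  rw [show 2 * (i + 1) + k - 2 * (i + 1) = k by omega,
    show 2 * (i + 1) + k - 2 * i = k + 2 by omega, show M - (i + 1) = k + r + 1 by omega,
    show M - i = k + r + 2 by omega, show M + (i + 1) - (2 * (i + 1) + k) = r + 1 by omega,
    show k + 2 - 1 = k + 1 by omega]
  calc 2 ^ k * (M.choose (i + 1) * (k + r + 1).choose k) * (2 * (i + 1) * (2 * (r + 1)))
      = 2 ^ (k + 2) * (M.choose (i + 1) * (i + 1)) * ((k + r + 1).choose k * (r + 1)) := by ring
    _ = 2 ^ (k + 2) * M.choose i * ((k + r + 2) * (k + r + 1).choose (k + 1)) * (k + 1) := by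
        rw [e1, ← e3]; ring
    _ = _ := by rw [← e2]; ring

lemma pairWeight_pos_iff {M a i : ℕ} (hi : 2 * i ≤ a) : 0 < pairWeight M a i ↔ a ≤ M + i := by
  constructor
  · intro h
    by_contra hlt
    rcases lt_or_ge M i with hMi | hMi
    · simp [pairWeight, Nat.choose_eq_zero_of_lt hMi] at h
    · have : (M - i).choose (a - 2 * i) = 0 := Nat.choose_eq_zero_of_lt (by omega)
      simp [pairWeight, this] at h
  · intro h
    exact Nat.mul_pos (by positivity)
      (Nat.mul_pos (Nat.choose_pos (by omega)) (Nat.choose_pos (by omega)))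

/-- A sequence which satisfies the recursion of the weights as an inequality is dominated by them
in the likelihood ratio order. -/
lemma mul_pairWeight_le {M a : ℕ} {N : ℕ → ℕ}
    (hN : ∀ i, 2 * (i + 1) ≤ a →
      N (i + 1) * (2 * (i + 1) * (2 * (M + (i + 1) - a))) ≤
        N i * ((a - 2 * i) * (a - 2 * i - 1)))
    {j i : ℕ} (hji : j ≤ i) (hi : 2 * i ≤ a) :
    N i * pairWeight M a j ≤ N j * pairWeight M a i := by
  rcases Nat.eq_zero_or_pos (pairWeight M a j) with h0 | hpos
  · simp [h0]
  have hM := (pairWeight_pos_iff (by omega)).1 hpos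
  induction i, hji using Nat.le_induction with
  | base => exact le_rfl
  | succ i hji ih =>
    have ih := ih (by omega)
    have h1 := hN i hi
    have h2 := pairWeight_succ (M := M) hi (by omega)
    have hw : 0 < pairWeight M a i := (pairWeight_pos_iff (by omega)).2 (by omega)
    have hc : 0 < 2 * (i + 1) * (2 * (M + (i + 1) - a)) :=
      Nat.mul_pos (by omega) (by omega)
    generalize 2 * (i + 1) * (2 * (M + (i + 1) - a)) = c at *
    generalize (a - 2 * i) * (a - 2 * i - 1) = e at *
    generalize pairWeight M a i = wi at *
    generalize pairWeight M a (i + 1) = wi' at *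
    generalize pairWeight M a j = wj at *
    refine Nat.le_of_mul_le_mul_left ?_ hc
    calc c * (N (i + 1) * wj) = N (i + 1) * c * wj := by ring
      _ ≤ N i * e * wj := Nat.mul_le_mul_right _ h1
      _ = N i * wj * e := by ring
      _ ≤ N j * wi * e := Nat.mul_le_mul_right _ ih
      _ = N j * (wi * e) := by ring
      _ = N j * (wi' * c) := by rw [h2]
      _ = c * (N j * wi') := by ring

/-- The likelihood ratio order gives stochastic domination: the fraction of the mass of `N` on
indices `≥ i₀` is at most the same fraction for the weights. -/
lemma sum_tail_mul_choose_le {M a : ℕ} {N : ℕ → ℕ}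
    (hN : ∀ i, 2 * (i + 1) ≤ a →
      N (i + 1) * (2 * (i + 1) * (2 * (M + (i + 1) - a))) ≤
        N i * ((a - 2 * i) * (a - 2 * i - 1))) (i₀ : ℕ) :
    (∑ i ∈ range (a / 2 + 1) with i₀ ≤ i, N i) * (2 * M).choose a ≤
      (∑ i ∈ range (a / 2 + 1), N i) *
        ∑ i ∈ range (a / 2 + 1) with i₀ ≤ i, pairWeight M a i := by
  rw [← sum_pairWeight, ← sum_filter_add_sum_filter_not (range (a / 2 + 1)) (fun i => i₀ ≤ i),
    ← sum_filter_add_sum_filter_not (range (a / 2 + 1)) (fun i => i₀ ≤ i) N, mul_add, add_mul]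
  refine Nat.add_le_add_left ?_ _
  rw [sum_mul_sum, sum_mul_sum, sum_comm]
  refine sum_le_sum fun j hj => sum_le_sum fun i hi => ?_
  simp only [Finset.mem_filter, mem_range] at hi hj
  exact mul_pairWeight_le hN (by omega) (by omega)

end Weights

/-! ### The probability that a given set has few outgoing edges -/

section FewCrossingEdges
open Finset
open scoped Classical

variable {n d : ℕ}

/-- At most `κ` edges leave `S` with at most the probability that at most `κ` pairs leave a set of
`d * #S` points in a random pairing of `2 * M = d * n - 2 * d ^ 2` points. The `2 * d ^ 2` missing
points are the loss in the switching inequality. -/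
lemma card_few_crossing_mul_choose_le (S : Finset (Fin n)) {M : ℕ}
    (hM : 2 * M + 2 * d ^ 2 = d * n) (κ : ℕ) :
    #{G ∈ regularGraphs n d | #(arcs G S Sᶜ) ≤ κ} * (2 * M).choose (d * #S) ≤
      #(regularGraphs n d) * ∑ i ∈ range (d * #S / 2 + 1) with d * #S - 2 * i ≤ κ,
        pairWeight M (d * #S) i := by
  set a := d * #S with ha
  have hab : a + d * (n - #S) = 2 * M + 2 * d ^ 2 := by
    rw [hM, ha, ← mul_add, Nat.add_sub_cancel' (card_finset_fin_le S)]
  have hN : ∀ i, 2 * (i + 1) ≤ a →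
      #(graphsWithCut d S (a - 2 * (i + 1))) * (2 * (i + 1) * (2 * (M + (i + 1) - a))) ≤
        #(graphsWithCut d S (a - 2 * i)) * ((a - 2 * i) * (a - 2 * i - 1)) := by
    intro i hi
    have := card_graphsWithCut_mul_le (d := d) S (a - 2 * (i + 1))
    rw [← ha] at this
    rwa [show a - (a - 2 * (i + 1)) = 2 * (i + 1) by omega,
      show d * (n - #S) - (a - 2 * (i + 1)) - 2 * d ^ 2 = 2 * (M + (i + 1) - a) by omega,
      show a - 2 * (i + 1) + 2 = a - 2 * i by omega,
      show a - 2 * (i + 1) + 1 = a - 2 * i - 1 by omega] at this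
  have htail := sum_tail_mul_choose_le (N := fun i => #(graphsWithCut d S (a - 2 * i))) hN
    ((a - κ + 1) / 2)
  have hfilter : ∀ i, (a - κ + 1) / 2 ≤ i ↔ a - 2 * i ≤ κ := fun i => by omega
  simp only [hfilter] at htail
  refine le_trans (Nat.mul_le_mul_right _ ?_) (htail.trans (Nat.mul_le_mul_right _ ?_))
  · refine le_trans (card_le_card fun G hG => ?_) card_biUnion_le
    obtain ⟨hG, hκ⟩ := Finset.mem_filter.1 hG
    obtain ⟨i, hi⟩ := even_card_arcs_self G S
    have hsum := card_arcs_add_compl hG S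
    rw [← ha] at hsum
    refine mem_biUnion.2 ⟨i, ?_, Finset.mem_filter.2 ⟨hG, ?_⟩⟩
    · rw [Finset.mem_filter, Finset.mem_range]; omega
    · omega
  · rw [← card_biUnion]
    · exact card_le_card (biUnion_subset.2 fun i _ => filter_subset _ _)
    · intro i hi j hj hij
      simp only [coe_range, Set.mem_Iio] at hi hj
      refine disjoint_filter.2 fun G _ h1 h2 => ?_
      omega

lemma choose_mul_choose_le_choose_add (m n i j : ℕ) :
    m.choose i * n.choose j ≤ (m + n).choose (i + j) := by
  rw [Nat.add_choose_eq]
  exact single_le_sum (f := fun ij : ℕ × ℕ => m.choose ij.1 * n.choose ij.2)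
    (fun _ _ => Nat.zero_le _) (a := (i, j)) (mem_antidiagonal.2 rfl)

/-- Two applications of Vandermonde's inequality. The first bounds the normalization
`(2 * M).choose a` from below; the second splits the number `n.choose s` of vertex sets off
`M.choose (a - i)`, so that the union bound is paid for exactly and `(M - n).choose (a - i - s)`
is left as the gain. -/
lemma choose_mul_pairWeight_mul_choose_le {M a i n s : ℕ} (hi : 2 * i ≤ a) (hs : s ≤ a - i)
    (hn : n ≤ M) :
    n.choose s * pairWeight M a i * (M - n).choose (a - i - s) ≤
      2 ^ (a - 2 * i) * M.choose (a - 2 * i) * (2 * M).choose a := by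
  have h1 : n.choose s * (M - n).choose (a - i - s) ≤ M.choose (a - i) := by
    have := choose_mul_choose_le_choose_add n (M - n) s (a - i - s)
    rwa [Nat.add_sub_cancel' hn, Nat.add_sub_cancel' hs] at this
  have h2 : M.choose i * M.choose (a - i) ≤ (2 * M).choose a := by
    have := choose_mul_choose_le_choose_add M M i (a - i)
    rwa [← two_mul, Nat.add_sub_cancel' (by omega)] at this
  have h3 : (M - i).choose (a - 2 * i) ≤ M.choose (a - 2 * i) :=
    Nat.choose_le_choose _ (Nat.sub_le _ _)
  calc n.choose s * pairWeight M a i * (M - n).choose (a - i - s)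
      = 2 ^ (a - 2 * i) * (M - i).choose (a - 2 * i) *
          (M.choose i * (n.choose s * (M - n).choose (a - i - s))) := by
        unfold pairWeight; ring
    _ ≤ 2 ^ (a - 2 * i) * M.choose (a - 2 * i) * (2 * M).choose a := by
        gcongr
        exact (Nat.mul_le_mul_left _ h1).trans h2

lemma div_pow_le_choose {N q : ℕ} (h : q ≤ N) : ((N : ℝ) / q) ^ q ≤ N.choose q := by
  induction q generalizing N with
  | zero => simp
  | succ q ih =>
    obtain ⟨N, rfl⟩ : ∃ N', N = N' + 1 := ⟨N - 1, by omega⟩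
    have hq : q ≤ N := by omega
    have hqN : (q : ℝ) ≤ N := by exact_mod_cast hq
    have hc : ((N + 1).choose (q + 1) : ℝ) = ((N + 1 : ℕ) : ℝ) / ((q + 1 : ℕ) : ℝ) * N.choose q := by
      rw [div_mul_eq_mul_div, eq_div_iff (by positivity)]
      exact_mod_cast (Nat.add_one_mul_choose_eq N q).symm
    rw [hc, pow_succ']
    refine mul_le_mul_of_nonneg_left (le_trans ?_ (ih hq)) (by positivity)
    rcases Nat.eq_zero_or_pos q with rfl | hq0
    · simp
    · have : (0 : ℝ) < q := by exact_mod_cast hq0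
      refine pow_le_pow_left₀ (by positivity) ?_ q
      push_cast
      rw [div_le_div_iff₀ (by positivity) this]
      nlinarith

lemma two_pow_mul_choose_le_exp {M k : ℕ} {t : ℝ} (ht : 0 < t) :
    (2 : ℝ) ^ k * M.choose k ≤ Real.exp (k * Real.log (2 / t) + t * M) := by
  have h1 : (M.choose k : ℝ) * t ^ k ≤ (1 + t) ^ M := by
    rcases lt_or_ge M k with h | h
    · rw [Nat.choose_eq_zero_of_lt h]; simp; positivity
    · rw [add_comm, add_pow]
      have := single_le_sum (f := fun m => t ^ m * 1 ^ (M - m) * (M.choose m : ℝ))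
        (fun _ _ => by positivity) (Finset.mem_range.2 (by omega : k < M + 1))
      simpa [mul_comm] using this
  have h2 : (1 + t) ^ M ≤ Real.exp (t * M) := by
    rw [mul_comm, Real.exp_nat_mul]
    exact pow_le_pow_left₀ (by positivity) (by linarith [Real.add_one_le_exp t]) M
  rw [Real.exp_add, Real.exp_nat_mul, Real.exp_log (by positivity), div_pow, div_mul_eq_mul_div,
    le_div_iff₀ (by positivity), mul_assoc]
  exact mul_le_mul_of_nonneg_left (h1.trans h2) (by positivity)

/-- The gain left by the union bound beats the entropy of the choice of `k ≤ s / (1000 d)` crossing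
pairs. Here `q` is `((d - 2) s + k) / 2 ≥ s / 2`, and `(M - n) / q` is nearly `n / s ≥ 2`. This is
where `d ≥ 3` enters. -/
lemma two_pow_mul_choose_le_mul_choose {s k q M : ℕ} (hd : 3 ≤ d) (hs : 1 ≤ s) (hsn : 2 * s ≤ n)
    (hn : 40 * d ^ 2 ≤ n) (hM : 2 * M + 2 * d ^ 2 = d * n) (hk : 1000 * d * k ≤ s)
    (hq : 2 * q + 2 * s = d * s + k) :
    (2 : ℝ) ^ k * M.choose k ≤
      (M - n).choose q * Real.exp (-(s / 4 * Real.log (n / s))) := by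
  have hd' : (3 : ℝ) ≤ d := by exact_mod_cast hd
  have hs' : (1 : ℝ) ≤ s := by exact_mod_cast hs
  have hsn' : (2 : ℝ) * s ≤ n := by exact_mod_cast hsn
  have hn' : 40 * (d : ℝ) ^ 2 ≤ n := by exact_mod_cast hn
  have hM' : 2 * (M : ℝ) + 2 * d ^ 2 = d * n := by exact_mod_cast hM
  have hk' : 1000 * (d : ℝ) * k ≤ s := by exact_mod_cast hk
  have hq' : 2 * (q : ℝ) + 2 * s = d * s + k := by exact_mod_cast hq
  have hs0 : (0 : ℝ) < s := by linarith
  have hn0 : (0 : ℝ) < n := by linarith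
  set L := Real.log (n / s) with hL
  have hL2 : 0.69 ≤ L := by
    have : Real.log 2 ≤ L := Real.log_le_log (by norm_num) (by rw [le_div_iff₀ hs0]; linarith)
    linarith [Real.log_two_gt_d9]
  have hnM : n ≤ M := by nlinarith
  have hMn : ((M - n : ℕ) : ℝ) = M - n := by push_cast [hnM]; ring
  have hk0 : (0 : ℝ) ≤ k := by positivity
  have hksmall : (k : ℝ) ≤ s / 1000 := by nlinarith
  have hqs : (s : ℝ) / 2 ≤ q := by nlinarith
  have hq0 : (0 : ℝ) < q := by linarith
  -- The parameter `t = s / (10 d n)` makes `t * M ≤ s / 20`, while `2 / t = 20 d n / s` enters only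
  -- through its logarithm, times `k ≤ s / (1000 d)`.
  have hup : (2 : ℝ) ^ k * M.choose k ≤ Real.exp (s * (0.07 + L / 3000)) := by
    refine (two_pow_mul_choose_le_exp (t := s / (10 * d * n)) (by positivity)).trans
      (Real.exp_le_exp.2 ?_)
    have h1 : Real.log (2 / (s / (10 * d * n))) ≤ 20 * d + L := by
      have : (2 : ℝ) / (s / (10 * d * n)) = (20 * d) * (n / s) := by field_simp; ring
      rw [this, Real.log_mul (by positivity) (by positivity)]
      have := Real.log_le_sub_one_of_pos (x := 20 * (d : ℝ)) (by positivity)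
      linarith
    have h2 : s / (10 * d * n) * (M : ℝ) ≤ s * 0.05 := by
      rw [div_mul_eq_mul_div, div_le_iff₀ (by positivity)]
      nlinarith [sq_nonneg (d : ℝ)]
    have h3 : (k : ℝ) * Real.log (2 / (s / (10 * d * n))) ≤ s * (0.02 + L / 3000) := by
      refine (mul_le_mul_of_nonneg_left h1 hk0).trans ?_
      have h4 : (k : ℝ) * d ≤ s / 1000 := by linarith
      have h5 : (k : ℝ) ≤ s / 3000 := by nlinarith
      have h6 := mul_le_mul_of_nonneg_right h5 (by linarith : 0 ≤ L)
      linarith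
    linarith
  -- `(M - n) / q ≥ 0.9 n / s`, and `log 0.9 ≥ -1 / 9`.
  have hlow : Real.exp (s / 2 * (L - 1 / 9)) ≤ (M - n).choose q := by
    have hratio : 0.9 * (n / s : ℝ) ≤ (M - n : ℕ) / q := by
      rw [hMn, le_div_iff₀ hq0, mul_div_assoc', div_mul_eq_mul_div, div_le_iff₀ hs0]
      have h1 : (q : ℝ) ≤ 1.001 * ((d - 2) * s / 2) := by nlinarith
      have h2 : 0.95 * ((d - 2) * n / 2) ≤ (M : ℝ) - n := by nlinarith
      have h3 := mul_le_mul_of_nonneg_left h1 hn0.le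
      have h4 := mul_le_mul_of_nonneg_right h2 hs0.le
      have h5 : (0 : ℝ) ≤ (d - 2) * s * n :=
        mul_nonneg (mul_nonneg (by linarith) hs0.le) hn0.le
      linarith
    have hns : (2 : ℝ) ≤ n / s := by rw [le_div_iff₀ hs0]; linarith
    have hqN : q ≤ M - n := by
      have : (1 : ℝ) ≤ (M - n : ℕ) / q := by linarith
      rw [le_div_iff₀ hq0, one_mul] at this
      exact_mod_cast this
    refine le_trans ?_ (div_pow_le_choose hqN)
    refine le_trans ?_ (pow_le_pow_left₀ (by positivity) hratio q)
    have hlog : L - 1 / 9 ≤ Real.log (0.9 * (n / s : ℝ)) := by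
      rw [Real.log_mul (by norm_num) (by positivity)]
      have := Real.one_sub_inv_le_log_of_pos (x := 0.9) (by norm_num)
      norm_num at this ⊢
      linarith
    have : (0.9 * (n / s : ℝ)) ^ q = Real.exp (q * Real.log (0.9 * (n / s : ℝ))) := by
      rw [Real.exp_nat_mul, Real.exp_log (by positivity)]
    rw [this]
    exact Real.exp_le_exp.2 (mul_le_mul hqs hlog (by linarith) (by positivity))
  refine hup.trans (le_trans ?_ (mul_le_mul_of_nonneg_right hlow (Real.exp_nonneg _)))
  rw [← Real.exp_add]
  refine Real.exp_le_exp.2 ?_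
  nlinarith

/-- The expected number of sets of size `#S` with few outgoing edges is small: the factor
`n.choose #S` counts those sets. -/
lemma choose_mul_card_few_crossing_le (hd : 3 ≤ d) (S : Finset (Fin n)) (hS : 1 ≤ #S)
    (hSn : 2 * #S ≤ n) (hn : 40 * d ^ 2 ≤ n) (hnd : Even (n * d)) :
    (n.choose #S : ℝ) * #{G ∈ regularGraphs n d | 1000 * d * #(arcs G S Sᶜ) ≤ #S} ≤
      #(regularGraphs n d) *
        ((d * #S + 1) * Real.exp (-(#S / 4 * Real.log (n / #S)))) := by
  set s := #S with hs
  obtain ⟨M, hM⟩ : ∃ M, 2 * M + 2 * d ^ 2 = d * n := by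
    obtain ⟨r, hr⟩ := hnd
    refine ⟨r - d ^ 2, ?_⟩
    have : 2 * d ^ 2 ≤ d * n := by nlinarith
    rw [mul_comm] at hr
    omega
  have hnM : n ≤ M := by nlinarith
  have h1 := card_few_crossing_mul_choose_le (d := d) S hM (s / (1000 * d))
  have hκ : ∀ k, k ≤ s / (1000 * d) ↔ 1000 * d * k ≤ s := fun k => by
    rw [Nat.le_div_iff_mul_le (by omega), mul_comm]
  simp only [hκ, ← hs] at h1
  set B := #{G ∈ regularGraphs n d | 1000 * d * #(arcs G S Sᶜ) ≤ s}
  set E := Real.exp (-(s / 4 * Real.log (n / s)))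
  have hC : (0 : ℝ) < (2 * M).choose (d * s) := by
    exact_mod_cast Nat.choose_pos (by nlinarith)
  have hterm : ∀ i ∈ range (d * s / 2 + 1), 1000 * d * (d * s - 2 * i) ≤ s →
      (n.choose s : ℝ) * pairWeight M (d * s) i ≤ (2 * M).choose (d * s) * E := by
    intro i hi hk
    rw [Finset.mem_range] at hi
    have hds : 3 * s ≤ d * s := Nat.mul_le_mul_right _ hd
    have hi2 : 2 * i ≤ d * s := by omega
    have h2 := choose_mul_pairWeight_mul_choose_le (M := M) (s := s) hi2 (by omega) hnM
    have h3 := two_pow_mul_choose_le_mul_choose (q := d * s - i - s) hd hS hSn hn hM hk (by omega)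
    have hpos : (0 : ℝ) < (M - n).choose (d * s - i - s) := by
      rcases Nat.eq_zero_or_pos ((M - n).choose (d * s - i - s)) with h0 | h0
      · rw [h0] at h3
        have h4 : (0 : ℝ) < 2 ^ (d * s - 2 * i) * M.choose (d * s - 2 * i) := by
          refine mul_pos (by positivity) (Nat.cast_pos.2 (Nat.choose_pos ?_))
          nlinarith
        simp only [Nat.cast_zero, zero_mul] at h3
        linarith
      · exact_mod_cast h0
    refine le_of_mul_le_mul_right ?_ hpos
    calc (n.choose s : ℝ) * pairWeight M (d * s) i * (M - n).choose (d * s - i - s)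
        ≤ 2 ^ (d * s - 2 * i) * M.choose (d * s - 2 * i) * (2 * M).choose (d * s) := by
          exact_mod_cast h2
      _ ≤ (M - n).choose (d * s - i - s) * E * (2 * M).choose (d * s) := by gcongr
      _ = _ := by ring
  refine le_of_mul_le_mul_right ?_ hC
  calc (n.choose s : ℝ) * B * (2 * M).choose (d * s)
      = n.choose s * ((B * (2 * M).choose (d * s) : ℕ) : ℝ) := by push_cast; ring
    _ ≤ n.choose s * ((#(regularGraphs n d) * ∑ i ∈ range (d * s / 2 + 1) with
          1000 * d * (d * s - 2 * i) ≤ s, pairWeight M (d * s) i : ℕ) : ℝ) := by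
        gcongr
    _ = #(regularGraphs n d) * ∑ i ∈ range (d * s / 2 + 1) with
          1000 * d * (d * s - 2 * i) ≤ s, (n.choose s : ℝ) * pairWeight M (d * s) i := by
        push_cast; rw [mul_sum, mul_sum, mul_sum]
        exact sum_congr rfl fun _ _ => by ring
    _ ≤ #(regularGraphs n d) * ((d * s + 1) * ((2 * M).choose (d * s) * E)) := by
        gcongr
        refine (sum_le_card_nsmul _ _ ((2 * M).choose (d * s) * E) fun i hi => ?_).trans ?_
        · rw [Finset.mem_filter] at hi
          exact hterm i hi.1 hi.2
        · rw [nsmul_eq_mul]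
          refine mul_le_mul_of_nonneg_right ?_ (by positivity)
          have : #{i ∈ range (d * s / 2 + 1) | 1000 * d * (d * s - 2 * i) ≤ s} ≤ d * s + 1 :=
            (card_filter_le _ _).trans (by rw [card_range]; omega)
          exact_mod_cast this
    _ = _ := by ring

end FewCrossingEdges

/-! ### Existence of regular graphs -/

section Existence
open Finset

/-- The connection set of a circulant graph: `±1, …, ±(d / 2)`, and `n / 2` if `d` is odd. -/
lemma exists_neg_invariant_finset {n d : ℕ} [NeZero n] (hn : 2 * d + 2 ≤ n) (hnd : Even (n * d)) :
    ∃ T : Finset (Fin n), (0 : Fin n) ∉ T ∧ (∀ x ∈ T, -x ∈ T) ∧ #T = d := by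
  classical
  set p : ℕ → Prop := fun x => (1 ≤ x ∧ x ≤ d / 2) ∨ n - d / 2 ≤ x ∨ (Odd d ∧ 2 * x = n) with hp
  refine ⟨({x : Fin n | p x} : Finset (Fin n)), ?_, ?_, ?_⟩
  · simp only [Finset.mem_filter, Finset.mem_univ, true_and, hp, Fin.val_zero]; omega
  · intro x hx
    simp only [Finset.mem_filter, Finset.mem_univ, true_and, hp] at hx ⊢
    have hxn := x.isLt
    rw [Fin.val_neg', Nat.mod_eq_of_lt (by omega)]
    rcases hx with hx | hx | ⟨hd, hx⟩
    · exact Or.inr (Or.inl (by omega))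
    · exact Or.inl (by omega)
    · exact Or.inr (Or.inr ⟨hd, by omega⟩)
  · have hcard : #{x : Fin n | p x} = #{x ∈ range n | p x} := by
      refine card_bij (fun x _ => (x : ℕ)) ?_ ?_ ?_
      · intro x hx; simpa using hx
      · intro x _ y _ h; exact Fin.ext h
      · intro y hy
        simp only [Finset.mem_filter, Finset.mem_range] at hy
        exact ⟨⟨y, hy.1⟩, by simpa using hy.2, rfl⟩
    rw [hcard]
    have hbase : #(Icc 1 (d / 2) ∪ Ico (n - d / 2) n) = 2 * (d / 2) := by
      rw [card_union_of_disjoint, Nat.card_Icc, Nat.card_Ico]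
      · omega
      · refine disjoint_left.2 fun x h1 h2 => ?_
        rw [Finset.mem_Icc] at h1; rw [Finset.mem_Ico] at h2; omega
    rcases Nat.even_or_odd d with hd | hd
    · have : {x ∈ range n | p x} = Icc 1 (d / 2) ∪ Ico (n - d / 2) n := by
        ext x
        have : ¬ Odd d := Nat.not_odd_iff_even.2 hd
        simp only [Finset.mem_filter, Finset.mem_range, Finset.mem_union, Finset.mem_Icc,
          Finset.mem_Ico, hp, this, false_and, or_false]
        omega
      rw [this, hbase, Nat.two_mul_div_two_of_even hd]
    · obtain ⟨r, hr⟩ : Even n := by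
        rcases Nat.even_mul.1 hnd with h | h
        · exact h
        · exact absurd h (Nat.not_even_iff_odd.2 hd)
      have : {x ∈ range n | p x} = insert (n / 2) (Icc 1 (d / 2) ∪ Ico (n - d / 2) n) := by
        ext x
        simp only [Finset.mem_filter, Finset.mem_range, Finset.mem_union, Finset.mem_Icc,
          Finset.mem_Ico, hp, hd, true_and, Finset.mem_insert]
        omega
      rw [this, card_insert_of_notMem, hbase]
      · have := Nat.two_mul_div_two_add_one_of_odd hd; omega
      · simp only [Finset.mem_union, Finset.mem_Icc, Finset.mem_Ico]; omega

lemma regularGraphs_nonempty {n d : ℕ} (hn : 2 * d + 2 ≤ n) (hnd : Even (n * d)) :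
    (regularGraphs n d).Nonempty := by
  classical
  have : NeZero n := ⟨by omega⟩
  obtain ⟨T, h0, hneg, hT⟩ := exists_neg_invariant_finset hn hnd
  let G : SimpleGraph (Fin n) :=
    { Adj := fun u v => v - u ∈ T
      symm := ⟨fun u v h => by rw [← neg_sub]; exact hneg _ h⟩
      loopless := ⟨fun u h => h0 (by simpa using h)⟩ }
  refine ⟨G, mem_regularGraphs.2 fun u => ?_⟩
  rw [← hT]
  refine card_bij (fun w _ => w - u) ?_ ?_ ?_
  · intro w hw; simpa [G] using hw
  · intro w _ z _ h; simpa using h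
  · intro t ht; exact ⟨t + u, by simpa [G] using ht, by simp⟩

end Existence

/-! ### Random regular graphs are edge expanders -/

section Expansion
open Finset
open scoped Classical

variable {n d : ℕ}

/-- Every nonempty set `S` of at most half of the vertices is left by more than
`#S / (1000 * d)` edges. -/
def IsEdgeExpander (d : ℕ) (G : SimpleGraph (Fin n)) : Prop :=
  ∀ S : Finset (Fin n), S.Nonempty → 2 * #S ≤ n → #S < 1000 * d * #(arcs G S Sᶜ)

lemma card_not_isEdgeExpander_le (hd : 3 ≤ d) (hn : 40 * d ^ 2 ≤ n) (hnd : Even (n * d)) :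
    (#{G ∈ regularGraphs n d | ¬ IsEdgeExpander d G} : ℝ) ≤ #(regularGraphs n d) *
      ∑ s ∈ Icc 1 (n / 2), (d * s + 1) * Real.exp (-(s / 4 * Real.log (n / s))) := by
  have hsub : {G ∈ regularGraphs n d | ¬ IsEdgeExpander d G} ⊆
      (Icc 1 (n / 2)).biUnion fun s => (powersetCard s univ).biUnion fun S =>
        {G ∈ regularGraphs n d | 1000 * d * #(arcs G S Sᶜ) ≤ #S} := by
    intro G hG
    obtain ⟨hG, hE⟩ := Finset.mem_filter.1 hG
    simp only [IsEdgeExpander, not_forall, not_lt] at hE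
    obtain ⟨S, hS, hSn, hle⟩ := hE
    simp only [Finset.mem_biUnion, Finset.mem_filter, Finset.mem_Icc, Finset.mem_powersetCard]
    have := hS.card_pos
    exact ⟨#S, by omega, S, ⟨subset_univ _, rfl⟩, hG, hle⟩
  have h1 := (card_le_card hsub).trans (card_biUnion_le.trans (sum_le_sum fun s _ =>
    card_biUnion_le))
  have h1' : (#{G ∈ regularGraphs n d | ¬ IsEdgeExpander d G} : ℝ) ≤
      ∑ s ∈ Icc 1 (n / 2), ∑ S ∈ powersetCard s (univ : Finset (Fin n)),
        (#{G ∈ regularGraphs n d | 1000 * d * #(arcs G S Sᶜ) ≤ #S} : ℝ) := by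
    exact_mod_cast h1
  refine h1'.trans ?_
  rw [mul_sum]
  refine sum_le_sum fun s hs => ?_
  rw [Finset.mem_Icc] at hs
  have hC : (0 : ℝ) < n.choose s := by exact_mod_cast Nat.choose_pos (by omega)
  set E := (#(regularGraphs n d) : ℝ) * ((d * s + 1) * Real.exp (-(s / 4 * Real.log (n / s))))
  have h2 : ∀ S ∈ powersetCard s (univ : Finset (Fin n)),
      (#{G ∈ regularGraphs n d | 1000 * d * #(arcs G S Sᶜ) ≤ #S} : ℝ) ≤ E / n.choose s := by
    intro S hS
    obtain ⟨-, hcard⟩ := mem_powersetCard.1 hS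
    rw [le_div_iff₀' hC]
    have := choose_mul_card_few_crossing_le hd S (by omega) (by omega) hn hnd
    rwa [hcard] at this ⊢
  refine (sum_le_card_nsmul _ _ _ h2).trans (le_of_eq ?_)
  rw [card_powersetCard, card_univ, Fintype.card_fin, nsmul_eq_mul, mul_div_cancel₀ _ hC.ne']

/-- Each term tends to zero, and since `n / s ≥ 2` the terms are dominated by a geometric series
times a linear factor. -/
lemma tendsto_sum_mul_exp_log (d : ℕ) :
    Tendsto (fun n : ℕ => ∑ s ∈ Icc 1 (n / 2),
      ((d : ℝ) * s + 1) * Real.exp (-(s / 4 * Real.log (n / s)))) atTop (𝓝 0) := by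
  set f : ℕ → ℕ → ℝ := fun n s => if s ∈ Icc 1 (n / 2) then
    ((d : ℝ) * s + 1) * Real.exp (-(s / 4 * Real.log (n / s))) else 0 with hf
  have hsum : (fun n : ℕ => ∑ s ∈ Icc 1 (n / 2),
      ((d : ℝ) * s + 1) * Real.exp (-(s / 4 * Real.log (n / s)))) = fun n => ∑' s, f n s := by
    funext n
    rw [tsum_eq_sum (s := Icc 1 (n / 2)) fun s hs => by simp only [hf, if_neg hs]]
    exact sum_congr rfl fun s hs => by simp only [hf, if_pos hs]
  have h0 : (0 : ℝ) = ∑' _ : ℕ, (0 : ℝ) := by simp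
  rw [hsum, h0]
  set r := Real.exp (-(Real.log 2 / 4)) with hr
  have hr1 : ‖r‖ < 1 := by
    rw [Real.norm_of_nonneg (Real.exp_nonneg _), Real.exp_lt_one_iff]
    have := Real.log_pos (x := 2) (by norm_num)
    linarith
  refine tendsto_tsum_of_dominated_convergence (bound := fun s : ℕ => ((d : ℝ) * s + 1) * r ^ s)
    ?_ ?_ ?_
  · have h1 := (summable_pow_mul_geometric_of_norm_lt_one 1 hr1).mul_left (d : ℝ)
    have h2 := summable_geometric_of_norm_lt_one hr1
    refine (h1.add h2).congr fun s => ?_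
    simp only [pow_one]; ring
  · intro s
    rcases Nat.eq_zero_or_pos s with rfl | hs
    · simp [hf]
    have hs' : (0 : ℝ) < s := by exact_mod_cast hs
    have hlog : Tendsto (fun n : ℕ => (s : ℝ) / 4 * Real.log (n / s)) atTop atTop :=
      (Real.tendsto_log_atTop.comp
        (tendsto_natCast_atTop_atTop.atTop_div_const hs')).const_mul_atTop (by positivity)
    have hlim : Tendsto (fun n : ℕ => ((d : ℝ) * s + 1) *
        Real.exp (-(s / 4 * Real.log (n / s)))) atTop (𝓝 0) := by
      simpa using ((Real.tendsto_exp_neg_atTop_nhds_zero.comp hlog).const_mul ((d : ℝ) * s + 1))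
    refine squeeze_zero (fun n => ?_) (fun n => ?_) hlim
    · simp only [hf]; split_ifs <;> positivity
    · simp only [hf]; split_ifs
      · exact le_rfl
      · positivity
  · refine Eventually.of_forall fun n s => ?_
    simp only [hf]
    split_ifs with hs
    · rw [Finset.mem_Icc] at hs
      have hs' : (0 : ℝ) < s := by exact_mod_cast hs.1
      rw [Real.norm_of_nonneg (by positivity), hr, ← Real.exp_nat_mul]
      gcongr
      have h2 : 2 * (s : ℝ) ≤ n := by
        have : 2 * s ≤ n := by omega
        exact_mod_cast this
      have : Real.log 2 ≤ Real.log (n / s) :=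
        Real.log_le_log (by norm_num) (by rw [le_div_iff₀ hs']; exact h2)
      nlinarith
    · rw [norm_zero]; positivity

/-- A property that follows from edge expansion for large `n` holds with high probability. -/
lemma whpRegular_of_isEdgeExpander (hd : 3 ≤ d) {P : ∀ n : ℕ, SimpleGraph (Fin n) → Prop}
    (hP : ∀ᶠ n in atTop, ∀ G ∈ regularGraphs n d, IsEdgeExpander d G → P n G) :
    WhpRegular d P := by
  unfold WhpRegular
  have hlim : Tendsto (fun n : ℕ => 1 - ∑ s ∈ Icc 1 (n / 2),
      ((d : ℝ) * s + 1) * Real.exp (-(s / 4 * Real.log (n / s))))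
      (atTop ⊓ 𝓟 {n : ℕ | Even (n * d)}) (𝓝 1) := by
    simpa using ((tendsto_sum_mul_exp_log d).const_sub 1).mono_left inf_le_left
  refine tendsto_of_tendsto_of_tendsto_of_le_of_le' hlim tendsto_const_nhds ?_ ?_
  · rw [eventually_inf_principal]
    filter_upwards [hP, eventually_ge_atTop (40 * d ^ 2), eventually_ge_atTop (2 * d + 2)]
      with n hPn hn hn' hnd
    have hpos : (0 : ℝ) < #(regularGraphs n d) := by
      exact_mod_cast (regularGraphs_nonempty hn' hnd).card_pos
    rw [probRegular, le_div_iff₀ hpos, sub_mul, one_mul, sub_le_iff_le_add]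
    have h1 := card_not_isEdgeExpander_le hd hn hnd
    have h2 := card_filter_add_card_filter_not (s := regularGraphs n d) (IsEdgeExpander d)
    have h3 : #{G ∈ regularGraphs n d | IsEdgeExpander d G} ≤
        #{G ∈ regularGraphs n d | P n G} := by
      refine card_le_card fun G hG => ?_
      rw [Finset.mem_filter] at hG ⊢
      exact ⟨hG.1, hPn G hG.1 hG.2⟩
    have h2' : (#{G ∈ regularGraphs n d | IsEdgeExpander d G} : ℝ) +
        #{G ∈ regularGraphs n d | ¬ IsEdgeExpander d G} = #(regularGraphs n d) := by
      exact_mod_cast h2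
    have h3' : (#{G ∈ regularGraphs n d | IsEdgeExpander d G} : ℝ) ≤
        #{G ∈ regularGraphs n d | P n G} := by exact_mod_cast h3
    rw [mul_comm] at h1
    linarith
  · refine Eventually.of_forall fun n => ?_
    refine div_le_one_of_le₀ ?_ (by positivity)
    exact_mod_cast card_filter_le _ _

end Expansion

/-! ### Lipschitz functions on expanders -/

section Tails
open Finset
open scoped Classical

variable {n d : ℕ}

lemma card_arcs_le {G : SimpleGraph (Fin n)} (hG : G ∈ regularGraphs n d)
    (S T : Finset (Fin n)) : #(arcs G S T) ≤ d * #T := by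
  rw [card_arcs_comm, card_arcs_eq_sum, mul_comm]
  refine sum_le_card_nsmul _ _ _ fun u _ => ?_
  rw [← mem_regularGraphs.1 hG u]
  exact card_le_card (filter_subset_filter _ (subset_univ _))

namespace IsEdgeExpander

/-- Edge expansion gives vertex expansion, since each vertex receives at most `d` edges from
`S`. -/
lemma mul_card_le {G : SimpleGraph (Fin n)} (hE : IsEdgeExpander d G)
    (hG : G ∈ regularGraphs n d) (hd : 0 < d) {S T : Finset (Fin n)} (hS : 2 * #S ≤ n)
    (hST : S ⊆ T) (hadj : ∀ u ∈ S, ∀ v, G.Adj u v → v ∈ T) :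
    (1 + 1 / (1000 * d ^ 2 : ℝ)) * #S ≤ #T := by
  rcases S.eq_empty_or_nonempty with rfl | hne
  · simp
  have h1 := hE S hne hS
  have h2 : arcs G S Sᶜ ⊆ arcs G S (T \ S) := by
    rintro ⟨u, v⟩ h
    rw [mem_arcs] at h ⊢
    exact ⟨h.1, Finset.mem_sdiff.2 ⟨hadj u h.1 v h.2.2, Finset.mem_compl.1 h.2.1⟩, h.2.2⟩
  have h3 := (card_le_card h2).trans (card_arcs_le hG _ _)
  have h4 := card_sdiff_add_card_eq_card hST
  have h5 : #S ≤ 1000 * d ^ 2 * #(T \ S) := by nlinarith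
  have h5' : (#S : ℝ) ≤ 1000 * d ^ 2 * #(T \ S) := by exact_mod_cast h5
  have h4' : (#(T \ S) : ℝ) + #S = #T := by exact_mod_cast h4
  have hd' : (0 : ℝ) < 1000 * d ^ 2 := by positivity
  rw [add_mul, one_mul, ← h4', div_mul_eq_mul_div, one_mul, add_comm]
  gcongr
  rwa [div_le_iff₀' hd']

/-- The closed neighbourhood of an upper level set of a Lipschitz function lies in the level set one
unit below. -/
lemma mul_card_superlevel_le {G : SimpleGraph (Fin n)} (hE : IsEdgeExpander d G)
    (hG : G ∈ regularGraphs n d) (hd : 0 < d) {g : Fin n → ℝ} (hg : IsLipschitzOn G g)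
    (hmed : 2 * #{v | 0 < g v} ≤ n) {r : ℝ} (hr : 0 < r) :
    (1 + 1 / (1000 * d ^ 2 : ℝ)) * #{v | r ≤ g v} ≤ #{v | r - 1 ≤ g v} := by
  refine hE.mul_card_le hG hd ?_ ?_ ?_
  · refine le_trans (Nat.mul_le_mul_left _ (card_le_card ?_)) hmed
    exact monotone_filter_right _ fun v _ hv => hr.trans_le hv
  · exact monotone_filter_right _ fun v _ hv => by linarith
  · intro u hu v huv
    simp only [Finset.mem_filter, Finset.mem_univ, true_and] at hu ⊢
    have := (abs_le.1 (hg u v huv)).2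
    linarith

/-- Both tails of a Lipschitz function with median `0` together decay exponentially. -/
lemma card_deviation_lt {G : SimpleGraph (Fin n)} (hE : IsEdgeExpander d G)
    (hG : G ∈ regularGraphs n d) (hd : 0 < d) (hn : 0 < n) {g : Fin n → ℝ}
    (hg : IsLipschitzOn G g) (hpos : 2 * #{v | 0 < g v} ≤ n) (hneg : 2 * #{v | 0 < - g v} ≤ n)
    {x : ℝ} (hx : 1 ≤ x) :
    (#{v | x ≤ |g v|} : ℝ) <
      Real.exp (-(Real.log (1 + 1 / (2000 * d ^ 2 : ℝ)) / 2) * x) * n := by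
  set ε : ℝ := 1 / (2000 * d ^ 2 : ℝ) with hε
  have hε2 : 1 / (1000 * d ^ 2 : ℝ) = 2 * ε := by rw [hε]; field_simp; norm_num
  have hε0 : 0 < ε := by positivity
  have hn' : (0 : ℝ) < n := by exact_mod_cast hn
  have hg' : IsLipschitzOn G fun v => - g v := fun v w h => by
    have := hg v w h
    rwa [neg_sub_neg, abs_sub_comm]
  have hA : ∀ r : ℝ, 0 < r → (1 + 2 * ε) * #{v | r ≤ g v} ≤ #{v | r - 1 ≤ g v} :=
    fun r hr => hε2 ▸ hE.mul_card_superlevel_le hG hd hg hpos hr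
  have hB : ∀ r : ℝ, 0 < r → (1 + 2 * ε) * #{v | r ≤ - g v} ≤ #{v | r - 1 ≤ - g v} :=
    fun r hr => hε2 ▸ hE.mul_card_superlevel_le hG hd hg' hneg hr
  set D : ℝ → ℝ := fun r => (#{v | r ≤ g v} : ℝ) + #{v | r ≤ - g v} with hD
  -- The bound `D 1 ≤ n` alone is not enough at `x = 1`. The strict gain comes from `{0 ≤ g}`, which
  -- contains the neighbourhood of `{1 ≤ g}` and is disjoint from `{g ≤ -1}`.
  have hone : ∀ r : ℝ, 1 ≤ r → (1 + ε) * D r ≤ n := by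
    intro r hr
    have h1 : ∀ h : Fin n → ℝ, (#{v | r - 1 ≤ h v} : ℝ) + #{v | r ≤ - h v} ≤ n := by
      intro h
      rw [← Nat.cast_add, ← card_union_of_disjoint]
      · exact_mod_cast card_finset_fin_le _
      · refine disjoint_filter.2 fun v _ h1 h2 => ?_
        linarith
    have h2 := h1 g
    have h3 := h1 fun v => - g v
    simp only [neg_neg] at h3
    have := hA r (by linarith)
    have := hB r (by linarith)
    simp only [hD]
    linarith
  have hgeom : ∀ k : ℕ, ∀ r : ℝ, 1 ≤ r → (1 + ε) ^ (k + 1) * D (r + k) ≤ n := by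
    intro k
    induction k with
    | zero => intro r hr; simpa using hone r hr
    | succ k ih =>
      intro r hr
      refine le_trans ?_ (ih r hr)
      rw [pow_succ, mul_assoc]
      refine mul_le_mul_of_nonneg_left ?_ (by positivity)
      have h1 := hA (r + (k + 1 : ℕ)) (by positivity)
      have h2 := hB (r + (k + 1 : ℕ)) (by positivity)
      rw [show r + ((k + 1 : ℕ) : ℝ) - 1 = r + k by push_cast; ring] at h1 h2
      have h3 : (0 : ℝ) ≤ ε * D (r + (k + 1 : ℕ)) := by positivity
      simp only [hD] at h3 ⊢
      linarith
  -- Steps of length one lead from `x` down to `x - (⌊x⌋₊ - 1) ≥ 1`.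
  have hfloor : 1 ≤ ⌊x⌋₊ := Nat.le_floor (by simpa using hx)
  have hcast : ((⌊x⌋₊ - 1 : ℕ) : ℝ) = ⌊x⌋₊ - 1 := by push_cast [hfloor]; ring
  have hfx : (⌊x⌋₊ : ℝ) ≤ x := Nat.floor_le (by linarith)
  have hxf : x < ⌊x⌋₊ + 1 := Nat.lt_floor_add_one x
  have hf1 : (1 : ℝ) ≤ ⌊x⌋₊ := by exact_mod_cast hfloor
  have hmain := hgeom (⌊x⌋₊ - 1) (x - ((⌊x⌋₊ - 1 : ℕ) : ℝ)) (by rw [hcast]; linarith)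
  rw [sub_add_cancel, Nat.sub_add_cancel hfloor] at hmain
  have hdev : (#{v | x ≤ |g v|} : ℝ) ≤ D x := by
    simp only [hD]
    rw [← Nat.cast_add]
    refine Nat.cast_le.2 (le_trans (card_le_card ?_) (card_union_le _ _))
    intro v
    simp only [Finset.mem_filter, Finset.mem_univ, true_and, Finset.mem_union]
    exact le_abs.1
  -- `⌊x⌋₊ > x / 2` for `x ≥ 1`, so the inequality is strict.
  have hexp : Real.exp (-(Real.log (1 + ε) / 2) * x) * (1 + ε) ^ ⌊x⌋₊ > 1 := by
    have : (1 + ε) ^ ⌊x⌋₊ = Real.exp (⌊x⌋₊ * Real.log (1 + ε)) := by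
      rw [Real.exp_nat_mul, Real.exp_log (by positivity)]
    rw [this, ← Real.exp_add, gt_iff_lt, Real.one_lt_exp_iff]
    have hlog : 0 < Real.log (1 + ε) := Real.log_pos (by linarith)
    have : 0 < Real.log (1 + ε) * (⌊x⌋₊ - x / 2) := mul_pos hlog (by linarith)
    linarith
  have hp : 0 < (1 + ε) ^ ⌊x⌋₊ := by positivity
  refine lt_of_mul_lt_mul_left ?_ hp.le
  calc (1 + ε) ^ ⌊x⌋₊ * (#{v | x ≤ |g v|} : ℝ) ≤ (1 + ε) ^ ⌊x⌋₊ * D x := by gcongr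
    _ ≤ n := hmain
    _ < Real.exp (-(Real.log (1 + ε) / 2) * x) * (1 + ε) ^ ⌊x⌋₊ * n := by nlinarith
    _ = _ := by ring

end IsEdgeExpander

lemma two_mul_card_not_le {p : Fin n → Prop} (h : n ≤ 2 * {v | p v}.ncard) :
    2 * #{v | ¬ p v} ≤ n := by
  have h1 : {v | p v}.ncard = #{v | p v} := by
    rw [← Set.ncard_coe_finset]; simp
  have h2 : #{v | p v} + #{v | ¬ p v} = n :=
    (card_filter_add_card_filter_not p).trans (by simp)
  omega

end Tails

theorem theorem1 (d : ℕ) (hd : 3 ≤ d) :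
    ∃ c : ℝ, 0 < c ∧
      WhpRegular d fun n G =>
        ∀ f : Fin n → ℝ, IsLipschitzOn G f →
          ∀ m : ℝ, IsMedian f m →
            ∀ x : ℝ, 1 ≤ x →
              ({v : Fin n | x ≤ |f v - m|}.ncard : ℝ) < Real.exp (-c * x) * (n : ℝ) := by
  classical
  have hd0 : (0 : ℝ) < d := by positivity
  refine ⟨Real.log (1 + 1 / (2000 * d ^ 2 : ℝ)) / 2, ?_, ?_⟩
  · have : 0 < Real.log (1 + 1 / (2000 * d ^ 2 : ℝ)) :=
      Real.log_pos (lt_add_of_pos_right _ (by positivity))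
    positivity
  refine whpRegular_of_isEdgeExpander hd ?_
  filter_upwards [eventually_gt_atTop 0] with n hn G hG hE f hf m hm x hx
  unfold IsMedian at hm
  rw [Fintype.card_fin] at hm
  have hpos := two_mul_card_not_le hm.1
  have hneg := two_mul_card_not_le hm.2
  have hg : IsLipschitzOn G fun v => f v - m := fun v w h => by
    simpa using hf v w h
  have key := hE.card_deviation_lt hG (by omega) hn hg
    (by simpa [sub_pos] using hpos) (by simpa [sub_pos] using hneg) hx
  rw [← Set.ncard_coe_finset] at key
  simpa using key
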